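/- **Setting.** Let $n\ge 2$, $m=2$, $N=5$, and $r_1=r_3=r_4=1$, $r_2=r_5=2$. Let $e_1,\dots,e_n$ be the standard basis of $\mathbb R^n$ and $\mathbf e_1$ the first standard basis vector of $\mathbb R^{n-1}$; write $\mathbf x=(x_1,\bar{\mathbf x})\in\mathbb R\times\mathbb R^{n-2}$ for $\mathbf x\in\mathbb R^{n-1}$ (the barred part is absent when $n=2$). For $s\in\{1,\dots,n\}$, $\mathbf x,\mathbf y\in\mathbb R^{n-1}$, $a\in\mathbb R^n$ put $$\tilde\alpha_s(\mathbf x)=(x_1,\dots,x_{s-1},0,x_s,\dots,x_{n-1}),\quad \alpha^*_s(a)=(a_1,\dots,a_{s-1},a_{s+1},\dots,a_n),$$ $$\alpha_s(\mathbf x)=\tilde\alpha_s(\mathbf x)+e_s,\quad \alpha_s^{t}(\mathbf x)=\alpha_s(\mathbf x)\cdot e_t,\quad b_s(\mathbf x,\mathbf y)=\tilde\alpha_s(\mathbf y)-(\mathbf x\cdot\mathbf y)e_s .$$ Let $Z=(Z',\boldsymbol\kappa)\in\mathbb R^{10n-5}\times\mathbb R^5=\mathbb R^{10n}$ with $$Z'=\big(p_1,p_2,q_3,q_4,\mathbf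 x_3,\bar{\mathbf x}_4,\{(\mathbf y^k_1,\mathbf y^k_2,\mathbf y^k_3,\bar{\mathbf y}^k_5)\}_{k=1,2}\big),\qquad \boldsymbol\kappa=(\kappa_1,\dots,\kappa_5),$$ where $p_1,p_2,q_3,q_4\in\mathbb R^2$, $q_i=(q_i^1,q_i^2)$, $\mathbf x_3,\mathbf y^k_j\in\mathbb R^{n-1}$ and $\bar{\mathbf x}_4,\bar{\mathbf y}_5^k\in\mathbb R^{n-2}$. Set $\mathbf x_4=(4,\bar{\mathbf x}_4)$ and $\mathbf x_5=2\mathbf e_1$. For $j=1,2$ let $c_j=1+\sum_{i=3}^4 q_i^j\,\alpha_{r_i}^{r_j}(\mathbf x_i)$ and $$\mathbf x_j=\alpha^*_{r_j}\Big(\frac{c_j}{\alpha_{r_5}^{r_j}(\mathbf x_5)}\,\alpha_{r_5}(\mathbf x_5)-\sum_{i=3}^4q_i^j\,\alpha_{r_i}(\mathbf x_i)\Big),$$ $$p_i=q_i^1p_1+q_i^2p_2\ (i=3,4),\qquad p_5=-\sum_{j=1}^2\frac{c_j}{\alpha_{r_5}^{r_j}(\mathbf x_5)}\,p_j .$$ Let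 $a_i=\alpha_{r_i}(\mathbf x_i)$ for $1\le i\le 5$ (with components $a_i^t=a_i\cdot e_t$). For $k=1,2$ let $\mathbf y_5^k=(y_{5,1}^k,\bar{\mathbf y}_5^k)$ and $\mathbf y_4^k$ be given by $$y_{5,1}^k=\frac{\sum_{j=1}^3\alpha^*_{r_j}(a_4-a_4^{r_j}a_j)\cdot\mathbf y_j^k+\overline{\alpha^*_{r_5}(a_4-a_4^{r_5}a_5)}\cdot\bar{\mathbf y}_5^k}{\alpha_{r_4}^{r_5}(\mathbf x_4)\,x_{5,1}-\alpha^*_{r_5}(\alpha_{r_4}(\mathbf x_4))\cdot\mathbf e_1},$$ $$\mathbf y_4^k=\alpha^*_{r_4}\Big[-b_{r_5}(\mathbf x_5,\mathbf y_5^k)-\sum_{j=1}^3 b_{r_j}(\mathbf x_j,\mathbf y^k_j)\Big].$$ (The denominators equal $2$, $1$ and $7$, so every quantity here is a polynomial in $Z'$.) For $1\le i\le5$ define $$h_i(Z')=(h_i^1,h_i^2)=\Big(p_i\otimes a_i,\ \begin{bmatrix}b_{r_i}(\mathbf x_i,\mathbf y_i^1)\\ b_{r_i}(\mathbf x_i,\mathbf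 y_i^2)\end{bmatrix}\Big)\in\mathbb R^{2\times n}\times\mathbb R^{2\times n},$$ $$\omega_i(Z')=\sum_{j<i}h_j(Z'),\qquad \zeta_i(Z)=\omega_i(Z')+\kappa_ih_i(Z').$$ Identify $\mathbb R^{2\times n}$ with $\mathbb R^{2n}$, and let $D$ denote the Jacobi matrix with respect to $Z\in\mathbb R^{10n}$. For $\mathbf H=(H_1,\dots,H_5)\in(\mathbb R^{2n\times2n})^5$ let $\mathbb J_i(\mathbf H,Z)$ and $\mathbb N_i(\mathbf H,Z)$ be the $10n\times10n$ matrices consisting of five stacked $2n\times 10n$ blocks, the $j$-th blocks being respectively $$H_jD(\zeta_j^1-\omega_i^1)(Z)-D(\zeta_j^2-\omega_i^2)(Z)$$ and $$H_jD(\zeta_j^1-\omega_i^1)(Z)-D(\zeta_j^2-\omega_i^2)(Z)+(H_i-H_j)\,D(\kappa_ih_i^1)(Z),$$ and put $\mathcal J_i=\det\mathbb J_i$ and $\mathcal N_i=\det\mathbb N_i$ $(1\le i\le5)$. **Theorem.** Let $\mathbb S^{2n\times2n}$ be the space of symmetric real $2n\times2n$ matrices and $\mathcal P_1=(\mathbb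 S^{2n\times2n})^5\times\mathbb R^{10n}$. Then $$\mathcal Q=\mathcal J_1\mathcal J_2\mathcal J_3\mathcal J_4\mathcal J_5\,\mathcal N_1\mathcal N_2\mathcal N_3\mathcal N_4\mathcal N_5$$ is not identically zero on $\mathcal P_1$, and the set $\mathcal P_0=\{(\mathbf H,Z)\in\mathcal P_1:\mathcal Q(\mathbf H,Z)\neq0\}$ is open and dense in $\mathcal P_1$. -/

import Mathlib

/-! Throughout `n = d + 2` with `d : ℕ` arbitrary, i.e. `n` is an arbitrary integer `≥ 2`; thus
`ℝⁿ = Fin (d + 2) → ℝ`, `ℝⁿ⁻¹ = Fin (d + 1) → ℝ`, `ℝⁿ⁻² = Fin d → ℝ`.  Moreover `m = 2`, `N = 5`,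
and all indices are zero-based (the index `i` of the mathematics is `i - 1` here). -/

noncomputable section

namespace TConfig

/-- Real `2 × n` matrices. -/
abbrev Mat (d : ℕ) : Type := Matrix (Fin 2) (Fin (d + 2)) ℝ

/-- Real `2n × 2n` matrices acting on `ℝ^{2 × n} ≅ ℝ^{2n}`; the index set of `ℝ^{2n}` is the set of
positions `(k, ℓ)` in a `2 × n` matrix. -/
abbrev BigMat (d : ℕ) : Type := Matrix (Fin 2 × Fin (d + 2)) (Fin 2 × Fin (d + 2)) ℝ

/-- The selected indices `r₁ = r₃ = r₄ = 1`, `r₂ = r₅ = 2`. -/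
def r (d : ℕ) : Fin 5 → Fin (d + 2) := ![0, 1, 0, 0, 1]

section Vectors

variable {d : ℕ}

/-- `α̃_s(x) = (x₁, …, x_{s-1}, 0, x_s, …, x_{n-1})`. -/
def alphaTilde (s : Fin (d + 2)) (x : Fin (d + 1) → ℝ) : Fin (d + 2) → ℝ :=
  Fin.insertNth (α := fun _ => ℝ) s 0 x

/-- `α*_s(a) = (a₁, …, a_{s-1}, a_{s+1}, …, a_n)`. -/
def alphaStar (s : Fin (d + 2)) (a : Fin (d + 2) → ℝ) : Fin (d + 1) → ℝ :=
  fun j => a (s.succAbove j)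

/-- `α_s(x) = α̃_s(x) + e_s`. -/
def alpha (s : Fin (d + 2)) (x : Fin (d + 1) → ℝ) : Fin (d + 2) → ℝ :=
  alphaTilde s x + Pi.single s 1

/-- `b_s(x, y) = α̃_s(y) - (x · y) e_s`. -/
def b (s : Fin (d + 2)) (x y : Fin (d + 1) → ℝ) : Fin (d + 2) → ℝ :=
  alphaTilde s y - Pi.single s (x ⬝ᵥ y)

/-- `β_s(x, Y)`: the `2 × n` matrix with rows `b_s(x, y¹)`, `b_s(x, y²)`. -/
def beta (s : Fin (d + 2)) (x : Fin (d + 1) → ℝ) (Y : Fin 2 → Fin (d + 1) → ℝ) : Mat d :=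
  Matrix.of fun k => b s x (Y k)

end Vectors

/-- The free parameters `V = (P, Q, X, Y)`, where `P = (p₁, p₂)`, `Q = (q₃, q₄)`,
`X = (x₃, x₄, x₅)`, and `Y` consists of `y k j = y_{j+1}^{k+1}` (`j = 0, 1, 2`) and
`ybar5 k = ȳ_5^{k+1}`. -/
structure Param (d : ℕ) where
  p1 : Fin 2 → ℝ
  p2 : Fin 2 → ℝ
  q3 : Fin 2 → ℝ
  q4 : Fin 2 → ℝ
  x3 : Fin (d + 1) → ℝ
  x4 : Fin (d + 1) → ℝ
  x5 : Fin (d + 1) → ℝ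
  y : Fin 2 → Fin 3 → Fin (d + 1) → ℝ
  ybar5 : Fin 2 → Fin d → ℝ

namespace Param

variable {d : ℕ} (V : Param d)

/-- `1 + ∑_{i=3}^{4} q_i^j α_{r_i}^{r_j}(x_i)`, for `j ∈ {1, 2}`. -/
def coef (j : Fin 2) : ℝ :=
  1 + V.q3 j * alpha (r d 2) V.x3 (r d (Fin.castLE (by omega) j))
    + V.q4 j * alpha (r d 3) V.x4 (r d (Fin.castLE (by omega) j))

/-- `coef j` divided by `α_{r_5}^{r_j}(x₅)`. -/
def ratio (j : Fin 2) : ℝ :=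
  V.coef j / alpha (r d 4) V.x5 (r d (Fin.castLE (by omega) j))

/-- The vector `a_j ∈ ℝⁿ` that determines `x_j` for `j ∈ {1, 2}`. -/
def aInit (j : Fin 2) : Fin (d + 2) → ℝ :=
  V.ratio j • alpha (r d 4) V.x5
    - (V.q3 j • alpha (r d 2) V.x3 + V.q4 j • alpha (r d 3) V.x4)

/-- `(p₁(V), …, p₅(V))`. -/
def p : Fin 5 → Fin 2 → ℝ :=
  ![V.p1, V.p2,
    V.q3 0 • V.p1 + V.q3 1 • V.p2,
    V.q4 0 • V.p1 + V.q4 1 • V.p2,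
    -(V.ratio 0 • V.p1 + V.ratio 1 • V.p2)]

/-- `(x₁(V), …, x₅(V))`. -/
def x : Fin 5 → Fin (d + 1) → ℝ :=
  ![alphaStar (r d 0) (V.aInit 0), alphaStar (r d 1) (V.aInit 1), V.x3, V.x4, V.x5]

/-- `a_i(V) = α_{r_i}(x_i(V))`. -/
def a (i : Fin 5) : Fin (d + 2) → ℝ := alpha (r d i) (V.x i)

/-- `Δ₂(x₄, x_{5,1}) = α_{r_4}^{r_5}(x₄) x_{5,1} - α*_{r_5}(α_{r_4}(x₄)) · e₁`. -/
def delta2 : ℝ :=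
  alpha (r d 3) V.x4 (r d 4) * V.x5 0 - alphaStar (r d 4) (alpha (r d 3) V.x4) 0

/-- The first coordinate `y_{5,1}^k(V)` of `y_5^k(V)`. -/
def y51 (k : Fin 2) : ℝ :=
  ((∑ j : Fin 3,
      alphaStar (r d (Fin.castLE (by omega) j))
        (V.a 3 - V.a 3 (r d (Fin.castLE (by omega) j)) • V.a (Fin.castLE (by omega) j))
        ⬝ᵥ V.y k j)
    + Fin.tail (alphaStar (r d 4) (V.a 3 - V.a 3 (r d 4) • V.a 4)) ⬝ᵥ V.ybar5 k) / V.delta2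

/-- `y_5^k(V) = (y_{5,1}^k(V), ȳ_5^k)`. -/
def y5 (k : Fin 2) : Fin (d + 1) → ℝ := Fin.cons (V.y51 k) (V.ybar5 k)

/-- `y_4^k(V)`. -/
def y4 (k : Fin 2) : Fin (d + 1) → ℝ :=
  alphaStar (r d 3)
    ((Pi.single (r d 4) (V.x 4 ⬝ᵥ V.y5 k) - alphaTilde (r d 4) (V.y5 k))
      + ∑ j : Fin 3,
          (Pi.single (r d (Fin.castLE (by omega) j)) (V.x (Fin.castLE (by omega) j) ⬝ᵥ V.y k j)
            - alphaTilde (r d (Fin.castLE (by omega) j)) (V.y k j)))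

/-- `Y_i(V) = (y_i^1(V), y_i^2(V))` for `1 ≤ i ≤ 5`. -/
def Y : Fin 5 → Fin 2 → Fin (d + 1) → ℝ :=
  ![fun k => V.y k 0, fun k => V.y k 1, fun k => V.y k 2, V.y4, V.y5]

/-- `g_i(V) = (p_i(V) ⊗ a_i(V), B_i(V))`, where `B_i(V) = β_{r_i}(x_i(V), Y_i(V))`. -/
def g (i : Fin 5) : Mat d × Mat d :=
  (Matrix.vecMulVec (V.p i) (V.a i), beta (r d i) (V.x i) (V.Y i))

/-- `σ_i(V) = g_1(V) + ⋯ + g_{i-1}(V)`. -/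
def sigma (i : Fin 5) : Mat d × Mat d := ∑ j ∈ Finset.Iio i, V.g j

/-- `η_i(V, κ) = σ_i(V) + κ_i g_i(V)`. -/
def eta (κ : Fin 5 → ℝ) (i : Fin 5) : Mat d × Mat d := V.sigma i + κ i • V.g i

end Param

/-- The `10n` coordinates of the reduced parameter
`Z = (p₁, p₂, q₃, q₄, x₃, x̄₄, Y, κ)`: `p i k` is the `k`-th coordinate of `p_i`, `q i k` that of
`q_{i+2}`, `x3 l` that of `x₃`, `xbar4 l` that of `x̄₄`, `y k j l` that of `y_j^k` (`j = 1, 2, 3`),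
`ybar5 k l` that of `ȳ_5^k`, and `kappa i` is `κ_i`. -/
inductive Coord (d : ℕ) : Type
  | p (i k : Fin 2)
  | q (i k : Fin 2)
  | x3 (l : Fin (d + 1))
  | xbar4 (l : Fin d)
  | y (k : Fin 2) (j : Fin 3) (l : Fin (d + 1))
  | ybar5 (k : Fin 2) (l : Fin d)
  | kappa (i : Fin 5)
  deriving DecidableEq

namespace Coord

/-- The coordinates, listed block by block. -/
def equivSum (d : ℕ) : Coord d ≃
    (Fin 2 × Fin 2) ⊕ (Fin 2 × Fin 2) ⊕ Fin (d + 1) ⊕ Fin d ⊕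
      (Fin 2 × (Fin 3 × Fin (d + 1) ⊕ Fin d)) ⊕ Fin 5 where
  toFun
    | p i k => .inl (i, k)
    | q i k => .inr (.inl (i, k))
    | x3 l => .inr (.inr (.inl l))
    | xbar4 l => .inr (.inr (.inr (.inl l)))
    | y k j l => .inr (.inr (.inr (.inr (.inl (k, .inl (j, l))))))
    | ybar5 k l => .inr (.inr (.inr (.inr (.inl (k, .inr l)))))
    | kappa i => .inr (.inr (.inr (.inr (.inr i))))
  invFun
    | .inl (i, k) => p i k
    | .inr (.inl (i, k)) => q i k
    | .inr (.inr (.inl l)) => x3 l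
    | .inr (.inr (.inr (.inl l))) => xbar4 l
    | .inr (.inr (.inr (.inr (.inl (k, .inl (j, l)))))) => y k j l
    | .inr (.inr (.inr (.inr (.inl (k, .inr l))))) => ybar5 k l
    | .inr (.inr (.inr (.inr (.inr i)))) => kappa i
  left_inv c := by cases c <;> rfl
  right_inv := by
    rintro (⟨_, _⟩ | ⟨_, _⟩ | _ | _ | ⟨_, ⟨_, _⟩ | _⟩ | _) <;> rfl

instance (d : ℕ) : Fintype (Coord d) := Fintype.ofEquiv _ (equivSum d).symm

/-- The number of coordinates is `10n`. -/
theorem card_eq (d : ℕ) : Fintype.card (Coord d) = 10 * (d + 2) := by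
  rw [Fintype.card_congr (equivSum d)]
  simp only [Fintype.card_sum, Fintype.card_prod, Fintype.card_fin]
  ring

/-- The position of each coordinate in the list `(p₁, p₂, q₃, q₄, x₃, x̄₄, Y, κ)`, where
`Y = (y_1^1, y_2^1, y_3^1, ȳ_5^1, y_1^2, y_2^2, y_3^2, ȳ_5^2)`. -/
def order (d : ℕ) : Coord d ≃ Fin (10 * (d + 2)) :=
  (equivSum d).trans <|
    (Equiv.sumCongr finProdFinEquiv <|
      (Equiv.sumCongr finProdFinEquiv <|
        (Equiv.sumCongr (Equiv.refl _) <|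
          (Equiv.sumCongr (Equiv.refl _) <|
            (Equiv.sumCongr
              ((Equiv.prodCongr (Equiv.refl _)
                ((Equiv.sumCongr finProdFinEquiv (Equiv.refl _)).trans finSumFinEquiv)).trans
                  finProdFinEquiv)
              (Equiv.refl _)).trans finSumFinEquiv).trans finSumFinEquiv).trans
                finSumFinEquiv).trans finSumFinEquiv).trans
      (finSumFinEquiv.trans (finCongr (by ring)))

end Coord

/-- The rows of five stacked blocks of `2n` rows each, listed lexicographically. -/
def rowOrder (d : ℕ) : Fin 5 × (Fin 2 × Fin (d + 2)) ≃ Fin (10 * (d + 2)) :=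
  (Equiv.prodCongr (Equiv.refl _) finProdFinEquiv).trans
    (finProdFinEquiv.trans (finCongr (by ring)))

section Reduced

variable {d : ℕ}

/-- `V(Z') = (p₁, p₂, q₃, q₄, x₃, (4, x̄₄), 2e₁, Y)`, where `Z = (Z', κ)`. -/
def toParam (Z : Coord d → ℝ) : Param d where
  p1 k := Z (.p 0 k)
  p2 k := Z (.p 1 k)
  q3 k := Z (.q 0 k)
  q4 k := Z (.q 1 k)
  x3 l := Z (.x3 l)
  x4 := Fin.cons 4 (fun l => Z (.xbar4 l))
  x5 := Pi.single 0 2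
  y k j l := Z (.y k j l)
  ybar5 k l := Z (.ybar5 k l)

/-- `h_i(Z') = g_i(V(Z'))`. -/
def h (i : Fin 5) (Z : Coord d → ℝ) : Mat d × Mat d := (toParam Z).g i

/-- `ω_i(Z') = σ_i(V(Z'))`. -/
def omega (i : Fin 5) (Z : Coord d → ℝ) : Mat d × Mat d := (toParam Z).sigma i

/-- `ζ_i(Z) = η_i(V(Z'), κ)`. -/
def zeta (i : Fin 5) (Z : Coord d → ℝ) : Mat d × Mat d :=
  (toParam Z).eta (fun j => Z (.kappa j)) i

/-- The Jacobi matrix `DF(Z) ∈ ℝ^{2n × 10n}` of a map `F : ℝ^{10n} → ℝ^{2 × n} ≅ ℝ^{2n}`. -/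
def jacobi (F : (Coord d → ℝ) → Mat d) (Z : Coord d → ℝ) :
    Matrix (Fin 2 × Fin (d + 2)) (Coord d) ℝ :=
  Matrix.of fun a c => fderiv ℝ (fun W => F W a.1 a.2) Z (Pi.single c 1)

/-- The `j`-th block `H_j D(ζ_j^1 - ω_i^1)(Z) - D(ζ_j^2 - ω_i^2)(Z)` of the matrix defining
`𝒥_i`. -/
def blockJ (i : Fin 5) (H : Fin 5 → BigMat d) (Z : Coord d → ℝ) (j : Fin 5) :
    Matrix (Fin 2 × Fin (d + 2)) (Coord d) ℝ :=
  H j * jacobi (fun W => (zeta j W).1 - (omega i W).1) Z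
    - jacobi (fun W => (zeta j W).2 - (omega i W).2) Z

/-- The `j`-th block of the matrix defining `𝒩_i`: the `j`-th block for `𝒥_i` plus
`(H_i - H_j) Df_i^1(Z)`, where `f_i^1(Z) = κ_i h_i^1(Z')`. -/
def blockN (i : Fin 5) (H : Fin 5 → BigMat d) (Z : Coord d → ℝ) (j : Fin 5) :
    Matrix (Fin 2 × Fin (d + 2)) (Coord d) ℝ :=
  blockJ i H Z j + (H i - H j) * jacobi (fun W => W (.kappa i) • (h i W).1) Z

/-- The determinant of the square matrix of size `10n` formed by stacking five blocks of
size `2n × 10n`. -/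
def stackDet (B : Fin 5 → Matrix (Fin 2 × Fin (d + 2)) (Coord d) ℝ) : ℝ :=
  (Matrix.reindex (rowOrder d) (Coord.order d)
    (Matrix.of fun (a : Fin 5 × (Fin 2 × Fin (d + 2))) c => B a.1 a.2 c)).det

/-- `𝒥_i(H_1, …, H_5, Z)`. -/
def J (i : Fin 5) (H : Fin 5 → BigMat d) (Z : Coord d → ℝ) : ℝ := stackDet (blockJ i H Z)

/-- `𝒩_i(H_1, …, H_5, Z)`. -/
def N (i : Fin 5) (H : Fin 5 → BigMat d) (Z : Coord d → ℝ) : ℝ := stackDet (blockN i H Z)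

end Reduced

/-- Symmetric real `2n × 2n` matrices, with the subspace topology. -/
abbrev SymMat (d : ℕ) : Type := {H : BigMat d // H.IsSymm}

/-- `𝒫₁ = (𝕊^{2n × 2n})⁵ × ℝ^{10n}`, with the product topology. -/
abbrev P1 (d : ℕ) : Type := (Fin 5 → SymMat d) × (Coord d → ℝ)

/-- `𝒬 = 𝒥_1 ⋯ 𝒥_5 𝒩_1 ⋯ 𝒩_5` on `𝒫₁`. -/
def Q {d : ℕ} (u : P1 d) : ℝ :=
  (∏ i : Fin 5, J i (fun j => (u.1 j : BigMat d)) u.2) *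
    ∏ i : Fin 5, N i (fun j => (u.1 j : BigMat d)) u.2

/-- `𝒫₀`, the set of points of `𝒫₁` at which `𝒬` does not vanish. -/
def P0 (d : ℕ) : Set (P1 d) := {u | Q u ≠ 0}

end TConfig

end

/-!
Each of the ten determinants `𝒥_i`, `𝒩_i` is a real analytic function of `(H, Z)`. If such a
function is nonzero at some `w`, then for every `u` its restriction to the line through `u` and `w`
has only isolated zeros, so it is nonzero arbitrarily close to `u` (`IsAnalytic.dense`). Hence the
non-vanishing set of each determinant is open and dense as soon as it is nonempty; `P0` is the
intersection of these ten sets. It remains to find, for each `i`, a point where `𝒥_i` and `𝒩_i` do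
not vanish.

That point is chosen so that the `10n × 10n` matrices fall apart. At `base` all `y`-coordinates
vanish, and `h²` is linear in them. So the first variation of `h²` involves only the variation of
the `y`-coordinates (`fderiv_h_snd`), while that of `h¹` never involves it (`fderiv_h_fst`). With
diagonal matrices `H_j` having entries `0` and `1` (`weight`), a row with entry `0` is, up to a row
operation in the case of `𝒩_i`, an equation for the variation of the `y`-coordinates alone; these
rows force that variation to vanish. The remaining rows then determine the variation of all other
coordinates. Moreover, the vectors `a_i` at `base` lie in the span of the first two basis vectors,
so the coordinates of `ℝⁿ` beyond the first two decouple, both from the first two and from each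
other. The kernel equations thus split into one numerical system of size `20` (`IsKer.y_zero` and
`IsKer.main_zero`) and, for each further coordinate, one of size `10` (`IsKer.ext_zero`). All of
them have only the zero solution, and `J_ne_zero` and `N_ne_zero` turn this into non-vanishing.
-/

noncomputable section

namespace TConfig

open scoped ContDiff
open Matrix

variable {d : ℕ}

/-! ### Coordinates of the elementary vectors -/

section Coordinates

variable (x y : Fin (d + 1) → ℝ) (a : Fin (d + 2) → ℝ) (l : Fin d) (m : Fin (d + 1))

theorem succ_eq_succAbove_zero : m.succ = (0 : Fin (d + 2)).succAbove m := by simp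

theorem zero_eq_succAbove_one : (0 : Fin (d + 2)) = (1 : Fin (d + 2)).succAbove 0 := by simp

theorem succ_succ_eq_succAbove_one : l.succ.succ = (1 : Fin (d + 2)).succAbove l.succ := by
  rw [← Fin.succ_zero_eq_one, Fin.succ_succAbove_succ, Fin.succAbove_zero]

@[simp] theorem alphaTilde_self (s : Fin (d + 2)) : alphaTilde s x s = 0 := by simp [alphaTilde]

@[simp] theorem alphaTilde_zero_succ : alphaTilde 0 x m.succ = x m := by
  rw [succ_eq_succAbove_zero, alphaTilde, Fin.insertNth_apply_succAbove]

@[simp] theorem alphaTilde_zero_one : alphaTilde 0 x 1 = x 0 := alphaTilde_zero_succ x 0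

@[simp] theorem alphaTilde_one_zero : alphaTilde 1 x 0 = x 0 := by
  rw [zero_eq_succAbove_one, alphaTilde, Fin.insertNth_apply_succAbove]

@[simp] theorem alphaTilde_one_succ_succ : alphaTilde 1 x l.succ.succ = x l.succ := by
  rw [succ_succ_eq_succAbove_one, alphaTilde, Fin.insertNth_apply_succAbove]

@[simp] theorem alphaStar_zero : alphaStar 0 a m = a m.succ := by
  rw [alphaStar, ← succ_eq_succAbove_zero]

@[simp] theorem alphaStar_one_zero : alphaStar 1 a 0 = a 0 := by
  rw [alphaStar, ← zero_eq_succAbove_one]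

@[simp] theorem alphaStar_one_succ : alphaStar 1 a l.succ = a l.succ.succ := by
  rw [alphaStar, ← succ_succ_eq_succAbove_one]

theorem succ_succ_ne_one : l.succ.succ ≠ (1 : Fin (d + 2)) := by
  rw [← Fin.succ_zero_eq_one, Ne, Fin.succ_inj]; exact Fin.succ_ne_zero l

@[simp] theorem alpha_self (s : Fin (d + 2)) : alpha s x s = 1 := by simp [alpha]

@[simp] theorem alpha_zero_succ : alpha 0 x m.succ = x m := by simp [alpha]

@[simp] theorem alpha_zero_one : alpha 0 x 1 = x 0 := alpha_zero_succ x 0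

@[simp] theorem alpha_one_zero : alpha 1 x 0 = x 0 := by simp [alpha]

@[simp] theorem alpha_one_succ_succ : alpha 1 x l.succ.succ = x l.succ := by
  simp [alpha, succ_succ_ne_one]

@[simp] theorem b_self (s : Fin (d + 2)) : b s x y s = -(x ⬝ᵥ y) := by simp [b]

@[simp] theorem b_zero_succ : b 0 x y m.succ = y m := by simp [b]

@[simp] theorem b_zero_one : b 0 x y 1 = y 0 := b_zero_succ x y 0

@[simp] theorem b_one_zero : b 1 x y 0 = y 0 := by simp [b]

@[simp] theorem b_one_succ_succ : b 1 x y l.succ.succ = y l.succ := by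
  simp [b, succ_succ_ne_one]

end Coordinates

@[simp] theorem r_zero : r d 0 = 0 := rfl
@[simp] theorem r_one : r d 1 = 1 := rfl
@[simp] theorem r_two : r d 2 = 0 := rfl
@[simp] theorem r_three : r d 3 = 0 := rfl
@[simp] theorem r_four : r d 4 = 1 := rfl

/-! ### Analyticity of the elementary vectors -/

section Analytic

variable {E : Type*} [NormedAddCommGroup E] [NormedSpace ℝ E]

theorem contDiff_dotProduct {ι : Type*} [Fintype ι] {f g : E → ι → ℝ}
    (hf : ∀ i, ContDiff ℝ ω fun e => f e i) (hg : ∀ i, ContDiff ℝ ω fun e => g e i) :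
    ContDiff ℝ ω fun e => f e ⬝ᵥ g e :=
  ContDiff.sum fun i _ => (hf i).mul (hg i)

theorem contDiff_alphaTilde (s : Fin (d + 2)) {x : E → Fin (d + 1) → ℝ}
    (hx : ∀ l, ContDiff ℝ ω fun e => x e l) (l : Fin (d + 2)) :
    ContDiff ℝ ω fun e => alphaTilde s (x e) l := by
  cases l using s.succAboveCases with
  | x => simpa [alphaTilde] using contDiff_const
  | p l => simpa [alphaTilde] using hx l

theorem contDiff_alpha (s : Fin (d + 2)) {x : E → Fin (d + 1) → ℝ}
    (hx : ∀ l, ContDiff ℝ ω fun e => x e l) (l : Fin (d + 2)) :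
    ContDiff ℝ ω fun e => alpha s (x e) l :=
  (contDiff_alphaTilde s hx l).add contDiff_const

theorem contDiff_single (s l : Fin (d + 2)) {f : E → ℝ} (hf : ContDiff ℝ ω f) :
    ContDiff ℝ ω fun e => (Pi.single s (f e) : Fin (d + 2) → ℝ) l := by
  rcases eq_or_ne l s with rfl | hl
  · simpa using hf
  · simpa [hl] using contDiff_const

theorem contDiff_b (s : Fin (d + 2)) {x y : E → Fin (d + 1) → ℝ}
    (hx : ∀ l, ContDiff ℝ ω fun e => x e l) (hy : ∀ l, ContDiff ℝ ω fun e => y e l)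
    (l : Fin (d + 2)) : ContDiff ℝ ω fun e => b s (x e) (y e) l :=
  (contDiff_alphaTilde s hy l).sub (contDiff_single s l (contDiff_dotProduct hx hy))

end Analytic

theorem contDiff_coord (c : Coord d) : ContDiff ℝ ω fun Z : Coord d → ℝ => Z c :=
  contDiff_apply ℝ ℝ c

/-! ### The reduced parametrization in coordinates -/

section ToParam

variable (Z : Coord d → ℝ)

@[simp] theorem delta2_toParam : (toParam Z).delta2 = 7 := by
  norm_num [Param.delta2, toParam]

theorem coef_zero_toParam :
    (toParam Z).coef 0 = 1 + Z (.q 0 0) + Z (.q 1 0) := by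
  simp [Param.coef, toParam]

theorem coef_one_toParam :
    (toParam Z).coef 1 = 1 + Z (.q 0 1) * Z (.x3 0) + Z (.q 1 1) * 4 := by
  simp [Param.coef, toParam]

theorem ratio_zero_toParam :
    (toParam Z).ratio 0 = (1 + Z (.q 0 0) + Z (.q 1 0)) / 2 := by
  rw [Param.ratio, coef_zero_toParam]; simp [toParam]

theorem ratio_one_toParam :
    (toParam Z).ratio 1 = 1 + Z (.q 0 1) * Z (.x3 0) + Z (.q 1 1) * 4 := by
  rw [Param.ratio, coef_one_toParam]; simp

end ToParam

/-! ### Analyticity of the parametrization and of the determinants -/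

section AnalyticToParam

theorem contDiff_x4 (l : Fin (d + 1)) : ContDiff ℝ ω fun Z : Coord d → ℝ => (toParam Z).x4 l := by
  cases l using Fin.cases with
  | zero => exact contDiff_const
  | succ l => exact contDiff_coord (.xbar4 l)

theorem contDiff_ratio (j : Fin 2) : ContDiff ℝ ω fun Z : Coord d → ℝ => (toParam Z).ratio j := by
  have q (i j : Fin 2) := contDiff_coord (d := d) (.q i j)
  have x := contDiff_coord (d := d) (.x3 0)
  fin_cases j
  · simp only [Fin.zero_eta, ratio_zero_toParam]; fun_prop
  · simp only [Fin.mk_one, ratio_one_toParam]; fun_prop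

theorem contDiff_aInit (j : Fin 2) (l : Fin (d + 2)) :
    ContDiff ℝ ω fun Z : Coord d → ℝ => (toParam Z).aInit j l := by
  have h3 : ContDiff ℝ ω fun Z : Coord d → ℝ => alpha (r d 2) (toParam Z).x3 l :=
    contDiff_alpha _ (fun l => contDiff_coord (.x3 l)) l
  have h4 : ContDiff ℝ ω fun Z : Coord d → ℝ => alpha (r d 3) (toParam Z).x4 l :=
    contDiff_alpha _ contDiff_x4 l
  have h5 : ContDiff ℝ ω fun Z : Coord d → ℝ => alpha (r d 4) (toParam Z).x5 l :=
    contDiff_const (c := alpha (r d 4) (Pi.single 0 2) l)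
  simp only [Param.aInit, Pi.sub_apply, Pi.add_apply, Pi.smul_apply, smul_eq_mul]
  exact ((contDiff_ratio j).mul h5).sub
    (((contDiff_coord (.q 0 j)).mul h3).add ((contDiff_coord (.q 1 j)).mul h4))

theorem contDiff_x (i : Fin 5) (l : Fin (d + 1)) :
    ContDiff ℝ ω fun Z : Coord d → ℝ => (toParam Z).x i l := by
  fin_cases i
  · exact contDiff_aInit 0 _
  · exact contDiff_aInit 1 _
  · exact contDiff_coord (.x3 l)
  · exact contDiff_x4 l
  · exact contDiff_const

theorem contDiff_a (i : Fin 5) (l : Fin (d + 2)) :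
    ContDiff ℝ ω fun Z : Coord d → ℝ => (toParam Z).a i l :=
  contDiff_alpha _ (contDiff_x i) l

theorem contDiff_p (i : Fin 5) (k : Fin 2) :
    ContDiff ℝ ω fun Z : Coord d → ℝ => (toParam Z).p i k := by
  have p (i k : Fin 2) := contDiff_coord (d := d) (.p i k)
  have q (i j : Fin 2) := contDiff_coord (d := d) (.q i j)
  have r (j : Fin 2) := contDiff_ratio (d := d) j
  fin_cases i
  · exact p 0 k
  · exact p 1 k
  · exact ((q 0 0).mul (p 0 k)).add ((q 0 1).mul (p 1 k))
  · exact ((q 1 0).mul (p 0 k)).add ((q 1 1).mul (p 1 k))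
  · exact (((r 0).mul (p 0 k)).add ((r 1).mul (p 1 k))).neg

theorem contDiff_a_sub_smul (i : Fin 5) (s l : Fin (d + 2)) :
    ContDiff ℝ ω fun Z : Coord d → ℝ =>
      ((toParam Z).a 3 - (toParam Z).a 3 s • (toParam Z).a i) l :=
  (contDiff_a 3 l).sub ((contDiff_a 3 s).mul (contDiff_a i l))

theorem contDiff_y5 (k : Fin 2) (l : Fin (d + 1)) :
    ContDiff ℝ ω fun Z : Coord d → ℝ => (toParam Z).y5 k l := by
  cases l using Fin.cases with
  | succ l => exact contDiff_coord (.ybar5 k l)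
  | zero =>
    simp only [Param.y5, Fin.cons_zero, Param.y51, delta2_toParam]
    refine ContDiff.div_const (ContDiff.add (ContDiff.sum fun j _ => contDiff_dotProduct
      (fun l => contDiff_a_sub_smul _ _ _) fun l => contDiff_coord (.y k j l))
      (contDiff_dotProduct (fun l => contDiff_a_sub_smul _ _ _)
        fun l => contDiff_coord (.ybar5 k l))) _

theorem contDiff_y4 (k : Fin 2) (l : Fin (d + 1)) :
    ContDiff ℝ ω fun Z : Coord d → ℝ => (toParam Z).y4 k l := by
  have y (j : Fin 3) (l : Fin (d + 1)) := contDiff_coord (d := d) (.y k j l)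
  simp only [Param.y4, alphaStar, Pi.add_apply, Pi.sub_apply, Finset.sum_apply]
  refine ContDiff.add ((contDiff_single _ _ (contDiff_dotProduct (contDiff_x 4)
    (contDiff_y5 k))).sub (contDiff_alphaTilde _ (contDiff_y5 k) _)) (ContDiff.sum fun j _ =>
      (contDiff_single _ _ (contDiff_dotProduct (contDiff_x _) (y j))).sub
        (contDiff_alphaTilde _ (y j) _))

theorem contDiff_Y (i : Fin 5) (k : Fin 2) (l : Fin (d + 1)) :
    ContDiff ℝ ω fun Z : Coord d → ℝ => (toParam Z).Y i k l := by
  fin_cases i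
  · exact contDiff_coord (.y k 0 l)
  · exact contDiff_coord (.y k 1 l)
  · exact contDiff_coord (.y k 2 l)
  · exact contDiff_y4 k l
  · exact contDiff_y5 k l

theorem contDiff_h_fst (i : Fin 5) (k : Fin 2) (l : Fin (d + 2)) :
    ContDiff ℝ ω fun Z : Coord d → ℝ => (h i Z).1 k l :=
  (contDiff_p i k).mul (contDiff_a i l)

theorem contDiff_h_snd (i : Fin 5) (k : Fin 2) (l : Fin (d + 2)) :
    ContDiff ℝ ω fun Z : Coord d → ℝ => (h i Z).2 k l :=
  contDiff_b _ (contDiff_x i) (contDiff_Y i k) l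

theorem zeta_sub_omega_fst (i j : Fin 5) (Z : Coord d → ℝ) (k : Fin 2) (l : Fin (d + 2)) :
    ((zeta j Z).1 - (omega i Z).1) k l =
      ∑ m ∈ Finset.Iio j, (h m Z).1 k l + Z (.kappa j) * (h j Z).1 k l
        - ∑ m ∈ Finset.Iio i, (h m Z).1 k l := by
  simp [zeta, omega, Param.eta, Param.sigma, h, Prod.fst_sum, Matrix.sum_apply]

theorem zeta_sub_omega_snd (i j : Fin 5) (Z : Coord d → ℝ) (k : Fin 2) (l : Fin (d + 2)) :
    ((zeta j Z).2 - (omega i Z).2) k l =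
      ∑ m ∈ Finset.Iio j, (h m Z).2 k l + Z (.kappa j) * (h j Z).2 k l
        - ∑ m ∈ Finset.Iio i, (h m Z).2 k l := by
  simp [zeta, omega, Param.eta, Param.sigma, h, Prod.snd_sum, Matrix.sum_apply]

theorem contDiff_zeta_sub_omega_fst (i j : Fin 5) (k : Fin 2) (l : Fin (d + 2)) :
    ContDiff ℝ ω fun Z : Coord d → ℝ => ((zeta j Z).1 - (omega i Z).1) k l := by
  simp only [zeta_sub_omega_fst]
  exact ((ContDiff.sum fun m _ => contDiff_h_fst m k l).add
    ((contDiff_coord _).mul (contDiff_h_fst j k l))).sub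
      (ContDiff.sum fun m _ => contDiff_h_fst m k l)

theorem contDiff_zeta_sub_omega_snd (i j : Fin 5) (k : Fin 2) (l : Fin (d + 2)) :
    ContDiff ℝ ω fun Z : Coord d → ℝ => ((zeta j Z).2 - (omega i Z).2) k l := by
  simp only [zeta_sub_omega_snd]
  exact ((ContDiff.sum fun m _ => contDiff_h_snd m k l).add
    ((contDiff_coord _).mul (contDiff_h_snd j k l))).sub
      (ContDiff.sum fun m _ => contDiff_h_snd m k l)

theorem contDiff_kappa_smul_h (i : Fin 5) (k : Fin 2) (l : Fin (d + 2)) :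
    ContDiff ℝ ω fun Z : Coord d → ℝ => (Z (.kappa i) • (h i Z).1) k l :=
  (contDiff_coord _).mul (contDiff_h_fst i k l)

variable {E : Type*} [NormedAddCommGroup E] [NormedSpace ℝ E]

theorem contDiff_jacobi {F : (Coord d → ℝ) → Mat d} {Z : E → Coord d → ℝ}
    (hF : ∀ k l, ContDiff ℝ ω fun W => F W k l) (hZ : ContDiff ℝ ω Z)
    (a : Fin 2 × Fin (d + 2)) (c : Coord d) :
    ContDiff ℝ ω fun e => jacobi F (Z e) a c :=
  (((hF a.1 a.2).fderiv_right (m := ω) le_rfl).comp hZ).clm_apply contDiff_const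

theorem contDiff_mul_jacobi {F : (Coord d → ℝ) → Mat d} {H : E → BigMat d}
    {Z : E → Coord d → ℝ} (hF : ∀ k l, ContDiff ℝ ω fun W => F W k l)
    (hH : ∀ a a', ContDiff ℝ ω fun e => H e a a') (hZ : ContDiff ℝ ω Z)
    (a : Fin 2 × Fin (d + 2)) (c : Coord d) :
    ContDiff ℝ ω fun e => (H e * jacobi F (Z e)) a c := by
  simp only [Matrix.mul_apply]
  exact ContDiff.sum fun a' _ => (hH a a').mul (contDiff_jacobi hF hZ a' c)

theorem contDiff_stackDet {B : E → Fin 5 → Matrix (Fin 2 × Fin (d + 2)) (Coord d) ℝ}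
    (hB : ∀ j a c, ContDiff ℝ ω fun e => B e j a c) :
    ContDiff ℝ ω fun e => stackDet (B e) := by
  simp only [stackDet, Matrix.det_apply]
  exact ContDiff.sum fun σ _ => (contDiff_prod fun i _ => hB _ _ _).const_smul _

theorem contDiff_blockJ (i : Fin 5) {H : E → Fin 5 → BigMat d} {Z : E → Coord d → ℝ}
    (hH : ∀ j a a', ContDiff ℝ ω fun e => H e j a a') (hZ : ContDiff ℝ ω Z)
    (j : Fin 5) (a : Fin 2 × Fin (d + 2)) (c : Coord d) :
    ContDiff ℝ ω fun e => blockJ i (H e) (Z e) j a c :=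
  (contDiff_mul_jacobi (contDiff_zeta_sub_omega_fst i j) (hH j) hZ a c).sub
    (contDiff_jacobi (contDiff_zeta_sub_omega_snd i j) hZ a c)

theorem contDiff_blockN (i : Fin 5) {H : E → Fin 5 → BigMat d} {Z : E → Coord d → ℝ}
    (hH : ∀ j a a', ContDiff ℝ ω fun e => H e j a a') (hZ : ContDiff ℝ ω Z)
    (j : Fin 5) (a : Fin 2 × Fin (d + 2)) (c : Coord d) :
    ContDiff ℝ ω fun e => blockN i (H e) (Z e) j a c :=
  (contDiff_blockJ i hH hZ j a c).add
    (contDiff_mul_jacobi (contDiff_kappa_smul_h i) (fun a a' => (hH i a a').sub (hH j a a'))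
      hZ a c)

theorem contDiff_J (i : Fin 5) {H : E → Fin 5 → BigMat d} {Z : E → Coord d → ℝ}
    (hH : ∀ j a a', ContDiff ℝ ω fun e => H e j a a') (hZ : ContDiff ℝ ω Z) :
    ContDiff ℝ ω fun e => J i (H e) (Z e) :=
  contDiff_stackDet (contDiff_blockJ i hH hZ)

theorem contDiff_N (i : Fin 5) {H : E → Fin 5 → BigMat d} {Z : E → Coord d → ℝ}
    (hH : ∀ j a a', ContDiff ℝ ω fun e => H e j a a') (hZ : ContDiff ℝ ω Z) :
    ContDiff ℝ ω fun e => N i (H e) (Z e) :=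
  contDiff_stackDet (contDiff_blockN i hH hZ)

end AnalyticToParam

/-! ### Genericity of non-vanishing -/

/-- `f` is a real analytic function of the matrix entries and of `Z`. Square matrices carry no
canonical norm, so this is expressed by composing `f` with families of pairs `(H, Z)` that depend
analytically on a parameter in an arbitrary normed space. -/
def IsAnalytic (f : (Fin 5 → BigMat d) → (Coord d → ℝ) → ℝ) : Prop :=
  ∀ ⦃E : Type⦄ [NormedAddCommGroup E] [NormedSpace ℝ E] (H : E → Fin 5 → BigMat d)
    (Z : E → Coord d → ℝ), (∀ j a a', ContDiff ℝ ω fun e => H e j a a') → ContDiff ℝ ω Z →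
    ContDiff ℝ ω fun e => f (H e) (Z e)

theorem IsAnalytic.continuous {f : (Fin 5 → BigMat d) → (Coord d → ℝ) → ℝ}
    (hf : IsAnalytic f) : Continuous fun u : P1 d => f (fun j => (u.1 j : BigMat d)) u.2 := by
  have key := (hf
    (E := (Fin 5 → Fin 2 × Fin (d + 2) → Fin 2 × Fin (d + 2) → ℝ) × (Coord d → ℝ))
    (fun e j => Matrix.of (e.1 j)) (fun e => e.2) (fun j a a' => ?_) contDiff_snd).continuous
  · refine key.comp (g := fun e => f (fun j => Matrix.of (e.1 j)) e.2)
      (f := fun u : P1 d => (fun j a a' => (u.1 j : BigMat d) a a', u.2)) ?_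
    exact (continuous_pi fun j => continuous_subtype_val.comp
      ((continuous_apply j).comp continuous_fst)).prodMk continuous_snd
  · have h1 : ContDiff ℝ ω fun e : (Fin 5 → Fin 2 × Fin (d + 2) → Fin 2 × Fin (d + 2) → ℝ) ×
        (Coord d → ℝ) => e.1 j a a' := by fun_prop
    exact h1

/-- The line `t ↦ (1 - t) u + t w` in `P1`. -/
def lineP1 (u w : P1 d) (t : ℝ) : P1 d :=
  (fun j => ⟨(1 - t) • (u.1 j : BigMat d) + t • (w.1 j : BigMat d),
    ((u.1 j).2.smul _).add ((w.1 j).2.smul _)⟩, (1 - t) • u.2 + t • w.2)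

theorem continuous_lineP1 (u w : P1 d) : Continuous (lineP1 u w) := by
  unfold lineP1
  refine (continuous_pi fun j => Continuous.subtype_mk ?_ _).prodMk ?_ <;> fun_prop

theorem IsAnalytic.dense {f : (Fin 5 → BigMat d) → (Coord d → ℝ) → ℝ} (hf : IsAnalytic f)
    {w : P1 d} (hw : f (fun j => (w.1 j : BigMat d)) w.2 ≠ 0) :
    Dense {u : P1 d | f (fun j => (u.1 j : BigMat d)) u.2 ≠ 0} := by
  intro u
  set g : ℝ → ℝ := fun t => f (fun j => ((lineP1 u w t).1 j : BigMat d)) (lineP1 u w t).2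
  have hg : ContDiff ℝ ω g := by
    refine hf _ _ (fun j a a' => ?_) ?_
    · simp only [lineP1, Matrix.add_apply, Matrix.smul_apply, smul_eq_mul]; fun_prop
    · simp only [lineP1]; fun_prop
  have hne : ∀ᶠ t in nhdsWithin (0 : ℝ) {0}ᶜ, g t ≠ 0 := by
    by_contra h0
    have ha : AnalyticOnNhd ℝ g Set.univ := contDiff_omega_iff_analyticOnNhd.1 hg
    have h1 : g 1 = 0 := ha.eqOn_zero_of_preconnected_of_frequently_eq_zero isPreconnected_univ
      (Set.mem_univ 0) ((Filter.not_eventually.1 h0).mono fun t ht => not_not.1 ht)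
      (Set.mem_univ 1)
    have hw' : lineP1 u w 1 = w := by ext <;> simp [lineP1]
    simp only [g, hw'] at h1
    exact hw h1
  have hu : lineP1 u w 0 = u := by ext <;> simp [lineP1]
  have hlim : Filter.Tendsto (lineP1 u w) (nhdsWithin 0 {0}ᶜ) (nhds u) := by
    conv_rhs => rw [← hu]
    exact (continuous_lineP1 u w).continuousAt.tendsto.mono_left nhdsWithin_le_nhds
  exact mem_closure_of_tendsto hlim hne

/-! ### First variation at the base point -/

/-- The base point: `p₁ = (1, 0)`, `p₂ = (0, 1)`, `q₃ = q₄ = (1, 1)`, `x₃ = e₁`, all `κ_i = -1`, and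
`x̄₄`, `y_j^k`, `ȳ_5^k` zero. -/
def base : Coord d → ℝ
  | .p i k => if i = k then 1 else 0
  | .q _ _ => 1
  | .x3 l => (Pi.single 0 1 : Fin (d + 1) → ℝ) l
  | .kappa _ => -1
  | _ => 0

/-- Multiplication of the `y`-coordinates by `t`. -/
def scaleY (t : ℝ) (Z : Coord d → ℝ) : Coord d → ℝ
  | .y k j l => t * Z (.y k j l)
  | .ybar5 k l => t * Z (.ybar5 k l)
  | c => Z c

/-- The first point with its `y`-coordinates replaced by those of the second. -/
def withY (Z v : Coord d → ℝ) : Coord d → ℝ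
  | .y k j l => v (.y k j l)
  | .ybar5 k l => v (.ybar5 k l)
  | c => Z c

theorem a_scaleY (t : ℝ) (Z : Coord d → ℝ) (i : Fin 5) :
    (toParam (scaleY t Z)).a i = (toParam Z).a i := rfl

theorem y51_scaleY (t : ℝ) (Z : Coord d → ℝ) (k : Fin 2) :
    (toParam (scaleY t Z)).y51 k = t * (toParam Z).y51 k := by
  have hy (j : Fin 3) : (toParam (scaleY t Z)).y k j = t • (toParam Z).y k j := rfl
  have hy5 : (toParam (scaleY t Z)).ybar5 k = t • (toParam Z).ybar5 k := rfl
  simp only [Param.y51, hy, hy5, a_scaleY, delta2_toParam, dotProduct_smul, smul_eq_mul,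
    ← Finset.mul_sum]
  ring

theorem y5_scaleY (t : ℝ) (Z : Coord d → ℝ) (k : Fin 2) :
    (toParam (scaleY t Z)).y5 k = t • (toParam Z).y5 k := by
  funext l
  cases l using Fin.cases with
  | zero => exact y51_scaleY t Z k
  | succ l => rfl

theorem alphaTilde_smul (s : Fin (d + 2)) (t : ℝ) (x : Fin (d + 1) → ℝ) :
    alphaTilde s (t • x) = t • alphaTilde s x := by
  funext l
  cases l using s.succAboveCases <;> simp [alphaTilde]

theorem b_smul (s : Fin (d + 2)) (t : ℝ) (x y : Fin (d + 1) → ℝ) :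
    b s x (t • y) = t • b s x y := by
  simp only [b, alphaTilde_smul, dotProduct_smul, Pi.single_smul, smul_sub]

theorem y4_scaleY (t : ℝ) (Z : Coord d → ℝ) (k : Fin 2) :
    (toParam (scaleY t Z)).y4 k = t • (toParam Z).y4 k := by
  have hy (j : Fin 3) : (toParam (scaleY t Z)).y k j = t • (toParam Z).y k j := rfl
  have hx : (toParam (scaleY t Z)).x = (toParam Z).x := rfl
  simp only [Param.y4, hy, hx, y5_scaleY, alphaTilde_smul, dotProduct_smul, Pi.single_smul,
    ← smul_sub, ← Finset.smul_sum, ← smul_add]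
  rfl

theorem Y_scaleY (t : ℝ) (Z : Coord d → ℝ) (i : Fin 5) (k : Fin 2) :
    (toParam (scaleY t Z)).Y i k = t • (toParam Z).Y i k := by
  fin_cases i
  · rfl
  · rfl
  · rfl
  · exact y4_scaleY t Z k
  · exact y5_scaleY t Z k

/-- The second component of `h_i` is linear in the `y`-coordinates. -/
theorem h_snd_scaleY (t : ℝ) (Z : Coord d → ℝ) (i : Fin 5) (k : Fin 2) (l : Fin (d + 2)) :
    (h i (scaleY t Z)).2 k l = t * (h i Z).2 k l := by
  have hx : (toParam (scaleY t Z)).x = (toParam Z).x := rfl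
  simp [h, Param.g, beta, hx, Y_scaleY, b_smul]

theorem h_snd_base (i : Fin 5) (k : Fin 2) (l : Fin (d + 2)) :
    (h i (base (d := d))).2 k l = 0 := by
  have : scaleY 0 (base (d := d)) = base := by funext c; cases c <;> simp [scaleY, base]
  rw [← this, h_snd_scaleY, zero_mul]

theorem hasDerivAt_line {F : (Coord d → ℝ) → ℝ} (hF : ContDiff ℝ ω F) (Z v : Coord d → ℝ) :
    HasDerivAt (fun t : ℝ => F (Z + t • v)) (fderiv ℝ F Z v) 0 := by
  have hl : HasDerivAt (fun t : ℝ => Z + t • v) v 0 := by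
    simpa using ((hasDerivAt_id (0 : ℝ)).smul_const v).const_add Z
  have hF' : HasFDerivAt F (fderiv ℝ F Z) (Z + (0 : ℝ) • v) := by
    simpa using (hF.differentiable (by simp)).differentiableAt.hasFDerivAt
  exact hF'.comp_hasDerivAt 0 hl

/-- As the `y`-coordinates vanish at the base point and `h_i²` is linear in them, only the variation
of the `y`-coordinates contributes to the first variation of `h_i²`. -/
theorem fderiv_h_snd (i : Fin 5) (k : Fin 2) (l : Fin (d + 2)) (v : Coord d → ℝ) :
    fderiv ℝ (fun W => (h i W).2 k l) base v = (h i (withY base v)).2 k l := by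
  have h1 := hasDerivAt_line (contDiff_h_snd i k l) base v
  -- Along the line through the base point, `h_i²` is `t` times its value at a point whose
  -- `y`-coordinates do not depend on `t`.
  have hline (t : ℝ) : base + t • v =
      scaleY t (withY base v + t • withY v (0 : Coord d → ℝ)) := by
    funext c; cases c <;> simp [scaleY, withY, base]
  simp only [hline, h_snd_scaleY] at h1
  have h2 := (hasDerivAt_id (0 : ℝ)).mul
    (hasDerivAt_line (contDiff_h_snd i k l) (withY base v) (withY v (0 : Coord d → ℝ)))
  simpa using h1.unique h2

/-- First variation of `p_i` at the base point, in the direction `v`. -/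
def dp (v : Coord d → ℝ) (k : Fin 2) : Fin 5 → ℝ :=
  ![v (.p 0 k), v (.p 1 k),
    v (.p 0 k) + v (.p 1 k) + v (.q 0 k),
    v (.p 0 k) + v (.p 1 k) + v (.q 1 k),
    -(3 / 2 * v (.p 0 k) + 6 * v (.p 1 k) +
      ![(v (.q 0 0) + v (.q 1 0)) / 2, v (.q 0 1) + v (.x3 0) + 4 * v (.q 1 1)] k)]

/-- First variation of `a_i` at the base point, in the direction `v`. -/
def da (v : Coord d → ℝ) (i : Fin 5) : Fin (d + 2) → ℝ :=
  Fin.cons (![0, v (.q 0 1) + 2 * v (.x3 0) + 7 * v (.q 1 1), 0, 0, 0] i) <|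
    Fin.cons (![-(v (.q 0 0) + 7 * v (.q 1 0)) / 2 - v (.x3 0), 0, v (.x3 0), 0, 0] i) fun l =>
      ![-(v (.x3 l.succ) + v (.xbar4 l)), -(v (.x3 l.succ) + v (.xbar4 l)), v (.x3 l.succ),
        v (.xbar4 l), 0] i

/-- The vectors `p_i` at the base point. -/
def pBase (k : Fin 2) : Fin 5 → ℝ := ![![1, 0] k, ![0, 1] k, 1, 1, -![3 / 2, 6] k]

/-- The vectors `a_i` at the base point. -/
def aBase (i : Fin 5) : Fin (d + 2) → ℝ :=
  Fin.cons (![1, 10, 1, 1, 2] i) <| Fin.cons (![-7 / 2, 1, 1, 4, 1] i) fun _ => 0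

theorem a_eq (Z : Coord d → ℝ) (i : Fin 5) : (toParam Z).a i =
    Fin.cons (![1, 2 * (1 + Z (.q 0 1) * Z (.x3 0) + Z (.q 1 1) * 4) - (Z (.q 0 1) + Z (.q 1 1)),
      1, 1, 2] i) (Fin.cons (![(1 + Z (.q 0 0) + Z (.q 1 0)) / 2 -
        (Z (.q 0 0) * Z (.x3 0) + Z (.q 1 0) * 4), 1, Z (.x3 0), 4, 1] i) fun l =>
      ![-(Z (.q 0 0) * Z (.x3 l.succ) + Z (.q 1 0) * Z (.xbar4 l)),
        -(Z (.q 0 1) * Z (.x3 l.succ) + Z (.q 1 1) * Z (.xbar4 l)), Z (.x3 l.succ),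
        Z (.xbar4 l), 0] i) := by
  funext l
  refine Fin.cases ?_ (Fin.cases ?_ fun l => ?_) l <;> fin_cases i <;>
    simp [Param.a, Param.x, Param.aInit, ratio_zero_toParam, ratio_one_toParam] <;>
    simp [toParam]
  ring

theorem p_base (i : Fin 5) (k : Fin 2) : (toParam (base (d := d))).p i k = pBase k i := by
  fin_cases i <;> fin_cases k <;>
    simp [Param.p, pBase, ratio_zero_toParam, ratio_one_toParam] <;>
    simp [toParam, base] <;> norm_num

theorem a_base (i : Fin 5) : (toParam (base (d := d))).a i = aBase i := by
  rw [a_eq, aBase]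
  congr 2
  · norm_num [base]
  · norm_num [base]
  · funext l; fin_cases i <;> simp [base]

theorem hasDerivAt_coord (v : Coord d → ℝ) (c : Coord d) :
    HasDerivAt (fun t : ℝ => (base + t • v : Coord d → ℝ) c) (v c) 0 := by
  simpa using ((hasDerivAt_id (0 : ℝ)).mul_const (v c)).const_add (base c)

theorem hasDerivAt_p (v : Coord d → ℝ) (i : Fin 5) (k : Fin 2) :
    HasDerivAt (fun t : ℝ => (toParam (base + t • v)).p i k) (dp v k i) 0 := by
  have hc := hasDerivAt_coord v
  have hr0 : HasDerivAt (fun t : ℝ => (toParam (base + t • v)).ratio 0)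
      ((v (.q 0 0) + v (.q 1 0)) / 2) 0 := by
    simp only [ratio_zero_toParam]
    exact (((hc (.q 0 0)).const_add 1).add (hc (.q 1 0))).div_const 2
  have hr1 : HasDerivAt (fun t : ℝ => (toParam (base + t • v)).ratio 1)
      (v (.q 0 1) + v (.x3 0) + 4 * v (.q 1 1)) 0 := by
    simp only [ratio_one_toParam]
    refine HasDerivAt.congr_deriv ((((hc (.q 0 1)).mul (hc (.x3 0))).const_add 1).add
      ((hc (.q 1 1)).mul_const 4)) ?_
    simp [base]; ring
  fin_cases i
  · exact hc (.p 0 k)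
  · exact hc (.p 1 k)
  · refine HasDerivAt.congr_deriv (((hc (.q 0 0)).mul (hc (.p 0 k))).add
      ((hc (.q 0 1)).mul (hc (.p 1 k)))) ?_
    fin_cases k <;> simp [dp, base, toParam] <;> ring
  · refine HasDerivAt.congr_deriv (((hc (.q 1 0)).mul (hc (.p 0 k))).add
      ((hc (.q 1 1)).mul (hc (.p 1 k)))) ?_
    fin_cases k <;> simp [dp, base, toParam] <;> ring
  · refine HasDerivAt.congr_deriv (((hr0.mul (hc (.p 0 k))).add (hr1.mul (hc (.p 1 k)))).neg) ?_
    fin_cases k <;> simp [dp, ratio_zero_toParam, ratio_one_toParam] <;> simp [base] <;> ring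

theorem hasDerivAt_a (v : Coord d → ℝ) (i : Fin 5) (l : Fin (d + 2)) :
    HasDerivAt (fun t : ℝ => (toParam (base + t • v)).a i l) (da v i l) 0 := by
  have hc := hasDerivAt_coord v
  have hconst (c : ℝ) : HasDerivAt (fun _ : ℝ => c) 0 0 := hasDerivAt_const 0 c
  simp only [a_eq]
  refine Fin.cases ?_ (Fin.cases ?_ fun l => ?_) l
  · fin_cases i
    · exact hconst 1
    · refine HasDerivAt.congr_deriv ((((((hc (.q 0 1)).mul (hc (.x3 0))).const_add 1).add
        ((hc (.q 1 1)).mul_const 4)).const_mul 2).sub ((hc (.q 0 1)).add (hc (.q 1 1)))) ?_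
      simp [da, base]; ring
    · exact hconst 1
    · exact hconst 1
    · exact hconst 2
  · fin_cases i
    · refine HasDerivAt.congr_deriv
        (((((hc (.q 0 0)).const_add 1).add (hc (.q 1 0))).div_const 2).sub
          (((hc (.q 0 0)).mul (hc (.x3 0))).add ((hc (.q 1 0)).mul_const 4))) ?_
      simp [da, base]; ring
    · exact hconst 1
    · exact hc (.x3 0)
    · exact hconst 4
    · exact hconst 1
  · fin_cases i
    · refine HasDerivAt.congr_deriv ((((hc (.q 0 0)).mul (hc (.x3 l.succ))).add
        ((hc (.q 1 0)).mul (hc (.xbar4 l)))).neg) ?_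
      simp [da, base]
    · refine HasDerivAt.congr_deriv ((((hc (.q 0 1)).mul (hc (.x3 l.succ))).add
        ((hc (.q 1 1)).mul (hc (.xbar4 l)))).neg) ?_
      simp [da, base]
    · exact hc (.x3 l.succ)
    · exact hc (.xbar4 l)
    · exact hconst 0

theorem h_fst_base (i : Fin 5) (k : Fin 2) (l : Fin (d + 2)) :
    (h i (base (d := d))).1 k l = pBase k i * aBase i l := by
  rw [← p_base i k (d := d), ← a_base]; rfl

theorem fderiv_h_fst (i : Fin 5) (k : Fin 2) (l : Fin (d + 2)) (v : Coord d → ℝ) :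
    fderiv ℝ (fun W => (h i W).1 k l) base v =
      dp v k i * aBase i l + pBase k i * da v i l := by
  have h1 := (hasDerivAt_p v i k).mul (hasDerivAt_a v i l)
  simp only [zero_smul, add_zero, p_base, a_base] at h1
  exact (hasDerivAt_line (contDiff_h_fst i k l) base v).unique h1

theorem x_withY (v : Coord d → ℝ) (i : Fin 5) :
    (toParam (withY base v)).x i = Pi.single 0 (![-7 / 2, 10, 1, 4, 2] i) := by
  have ha (l : Fin (d + 2)) : alpha (r d i) ((toParam (withY base v)).x i) l = aBase i l := by
    rw [← a_base i (d := d)]; rfl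
  funext l
  cases l using Fin.cases with
  | zero =>
    have h0 := ha 0
    have h1 := ha (Fin.succ 0)
    fin_cases i <;> simp [aBase] at h0 h1 ⊢ <;> assumption
  | succ l =>
    have h1 := ha l.succ.succ
    fin_cases i <;> simpa [aBase] using h1

theorem a_withY (v : Coord d → ℝ) (i : Fin 5) : (toParam (withY base v)).a i = aBase i := by
  rw [← a_base]; rfl

/-- The first coordinate of `y₅^k` at the base point with its `y`-coordinates replaced. -/
theorem y51_withY (v : Coord d → ℝ) (k : Fin 2) : (toParam (withY base v)).y51 k =
    (15 / 2 * v (.y k 0 0) - 39 * v (.y k 1 0) + 3 * v (.y k 2 0)) / 7 := by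
  simp only [Param.y51, delta2_toParam, a_withY]
  congr 1
  simp [dotProduct, Fin.sum_univ_succ, aBase, Fin.tail, toParam, withY]
  ring

theorem y4_withY_zero (v : Coord d → ℝ) (k : Fin 2) : (toParam (withY base v)).y4 k 0 =
    2 * (toParam (withY base v)).y51 k - v (.y k 0 0) + 10 * v (.y k 1 0) - v (.y k 2 0) := by
  simp only [Param.y4, x_withY, Fin.sum_univ_three]
  simp [Param.y5]
  simp [toParam, withY]
  ring

theorem y4_withY_succ (v : Coord d → ℝ) (k : Fin 2) (l : Fin d) :
    (toParam (withY base v)).y4 k l.succ = -(v (.y k 0 l.succ) + v (.y k 1 l.succ)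
      + v (.y k 2 l.succ) + v (.ybar5 k l)) := by
  simp only [Param.y4, x_withY, Fin.sum_univ_three]
  simp [Param.y5, succ_succ_ne_one]
  simp [toParam, withY]
  ring

theorem h_snd_withY_zero (v : Coord d → ℝ) (k : Fin 2) (i : Fin 5) :
    (h i (withY base v)).2 k 0 = ![7 / 2 * v (.y k 0 0), v (.y k 1 0), -v (.y k 2 0),
      -4 * (toParam (withY base v)).y4 k 0, (toParam (withY base v)).y51 k] i := by
  simp only [h, Param.g, beta, Matrix.of_apply, x_withY]
  fin_cases i <;> simp [Param.Y, Param.y5] <;>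
    simp [toParam, withY] <;> ring

theorem h_snd_withY_one (v : Coord d → ℝ) (k : Fin 2) (i : Fin 5) :
    (h i (withY base v)).2 k 1 = ![v (.y k 0 0), -10 * v (.y k 1 0), v (.y k 2 0),
      (toParam (withY base v)).y4 k 0, -2 * (toParam (withY base v)).y51 k] i := by
  simp only [h, Param.g, beta, Matrix.of_apply, x_withY]
  fin_cases i <;> simp [Param.Y, Param.y5] <;> simp [toParam, withY]

theorem h_snd_withY_succ_succ (v : Coord d → ℝ) (k : Fin 2) (l : Fin d) (i : Fin 5) :
    (h i (withY base v)).2 k l.succ.succ = ![v (.y k 0 l.succ), v (.y k 1 l.succ),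
      v (.y k 2 l.succ), -(v (.y k 0 l.succ) + v (.y k 1 l.succ) + v (.y k 2 l.succ)
        + v (.ybar5 k l)), v (.ybar5 k l)] i := by
  simp only [h, Param.g, beta, Matrix.of_apply, x_withY]
  fin_cases i <;> simp [Param.Y, Param.y5, y4_withY_succ] <;>
    simp [toParam, withY]

/-! ### Kernels of the stacked matrices -/

theorem stackDet_ne_zero {B : Fin 5 → Matrix (Fin 2 × Fin (d + 2)) (Coord d) ℝ}
    (hB : ∀ v : Coord d → ℝ, (∀ j a, (B j *ᵥ v) a = 0) → v = 0) : stackDet B ≠ 0 := by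
  intro h0
  obtain ⟨w, hw, hBw⟩ := Matrix.exists_mulVec_eq_zero_iff.2 h0
  refine hw ?_
  have hv := hB (w ∘ Coord.order d) fun j a => by
    have := congrFun hBw (rowOrder d (j, a))
    rw [Matrix.reindex_apply, Matrix.submatrix_mulVec_equiv] at this
    simpa [Matrix.mulVec, dotProduct] using this
  funext c
  simpa using congrFun hv ((Coord.order d).symm c)

theorem jacobi_mulVec (F : (Coord d → ℝ) → Mat d) (Z v : Coord d → ℝ)
    (a : Fin 2 × Fin (d + 2)) :
    (jacobi F Z *ᵥ v) a = fderiv ℝ (fun W => F W a.1 a.2) Z v := by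
  simp only [Matrix.mulVec, dotProduct, jacobi, Matrix.of_apply]
  conv_rhs => rw [← Finset.univ_sum_single v, map_sum]
  refine Finset.sum_congr rfl fun c _ => ?_
  rw [mul_comm, ← smul_eq_mul, ← map_smul, ← Pi.single_smul, smul_eq_mul, mul_one]

/-- The combination of variations `D_m` of the `h_m` that enters the variation of `ζ_j - ω_i` when
`κ_j = -1`. -/
def shift (i j : Fin 5) (D : Fin 5 → ℝ) : ℝ :=
  ∑ m ∈ Finset.Iio j, D m - D j - ∑ m ∈ Finset.Iio i, D m

theorem fderiv_shift {f : Fin 5 → (Coord d → ℝ) → ℝ} (hf : ∀ m, ContDiff ℝ ω (f m))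
    (i j : Fin 5) (v : Coord d → ℝ) :
    fderiv ℝ (fun Z => ∑ m ∈ Finset.Iio j, f m Z + Z (.kappa j) * f j Z
        - ∑ m ∈ Finset.Iio i, f m Z) base v =
      shift i j (fun m => fderiv ℝ (f m) base v) + v (.kappa j) * f j base := by
  have hd (m : Fin 5) := hasDerivAt_line (hf m) base v
  have h1 := ((HasDerivAt.fun_sum (u := Finset.Iio j) fun m _ => hd m).add
    ((hasDerivAt_coord v (.kappa j)).mul (hd j))).sub
      (HasDerivAt.fun_sum (u := Finset.Iio i) fun m _ => hd m)
  have h2 := hasDerivAt_line (F := fun Z => ∑ m ∈ Finset.Iio j, f m Z + Z (.kappa j) * f j Z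
    - ∑ m ∈ Finset.Iio i, f m Z) (((ContDiff.sum fun m _ => hf m).add
      ((contDiff_coord _).mul (hf j))).sub (ContDiff.sum fun m _ => hf m)) base v
  rw [h2.unique h1]
  simp [shift, base]
  ring

/-- First variation of `h_m¹` at the base point. -/
def dh₁ (v : Coord d → ℝ) (a : Fin 2 × Fin (d + 2)) (m : Fin 5) : ℝ :=
  dp v a.1 m * aBase m a.2 + pBase a.1 m * da v m a.2

/-- The value of `h_m¹` at the base point, times the variation of `κ_m`. -/
def dκh₁ (v : Coord d → ℝ) (a : Fin 2 × Fin (d + 2)) (m : Fin 5) : ℝ :=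
  v (.kappa m) * (pBase a.1 m * aBase m a.2)

/-- First variation of `h_m²` at the base point. -/
def dh₂ (v : Coord d → ℝ) (a : Fin 2 × Fin (d + 2)) (m : Fin 5) : ℝ :=
  (h m (withY base v)).2 a.1 a.2

theorem jacobi_zeta_fst (i j : Fin 5) (v : Coord d → ℝ) (a : Fin 2 × Fin (d + 2)) :
    (jacobi (fun W => (zeta j W).1 - (omega i W).1) base *ᵥ v) a =
      shift i j (dh₁ v a) + dκh₁ v a j := by
  simp only [jacobi_mulVec, zeta_sub_omega_fst]
  rw [fderiv_shift fun m => contDiff_h_fst m a.1 a.2]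
  simp only [fderiv_h_fst, h_fst_base]
  rfl

theorem jacobi_zeta_snd (i j : Fin 5) (v : Coord d → ℝ) (a : Fin 2 × Fin (d + 2)) :
    (jacobi (fun W => (zeta j W).2 - (omega i W).2) base *ᵥ v) a = shift i j (dh₂ v a) := by
  simp only [jacobi_mulVec, zeta_sub_omega_snd]
  rw [fderiv_shift fun m => contDiff_h_snd m a.1 a.2]
  simp only [fderiv_h_snd, h_snd_base, mul_zero, add_zero]
  rfl

theorem jacobi_kappa_smul (i : Fin 5) (v : Coord d → ℝ) (a : Fin 2 × Fin (d + 2)) :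
    (jacobi (fun W => W (.kappa i) • (h i W).1) base *ᵥ v) a = dκh₁ v a i - dh₁ v a i := by
  simp only [jacobi_mulVec]
  have h1 := hasDerivAt_line (contDiff_kappa_smul_h i a.1 a.2) base v
  have h2 := (hasDerivAt_coord v (.kappa i)).mul
    (hasDerivAt_line (contDiff_h_fst i a.1 a.2) base v)
  rw [h1.unique h2, fderiv_h_fst]
  simp [h_fst_base, base, dκh₁, dh₁]
  ring

/-- The equations for `v` to lie in the kernel of the matrix defining `𝒥_i` (for `c = 0`) or `𝒩_i`
(for `c = 1`), at the base point and with `H_j` the diagonal matrix with entries `s j`. -/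
def IsKer (c : ℝ) (i : Fin 5) (s : Fin 5 → Fin 2 × Fin (d + 2) → ℝ) (v : Coord d → ℝ) : Prop :=
  ∀ j a, s j a * (shift i j (dh₁ v a) + dκh₁ v a j) - shift i j (dh₂ v a)
    + c * (s i a - s j a) * (dκh₁ v a i - dh₁ v a i) = 0

theorem J_ne_zero {i : Fin 5} {s : Fin 5 → Fin 2 × Fin (d + 2) → ℝ}
    (hs : ∀ v, IsKer 0 i s v → v = 0) : J i (fun j => Matrix.diagonal (s j)) base ≠ 0 := by
  refine stackDet_ne_zero fun v hv => hs v fun j a => ?_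
  have := hv j a
  rw [blockJ, Matrix.sub_mulVec, ← Matrix.mulVec_mulVec, Pi.sub_apply, Matrix.mulVec_diagonal,
    jacobi_zeta_fst, jacobi_zeta_snd] at this
  linarith

theorem N_ne_zero {i : Fin 5} {s : Fin 5 → Fin 2 × Fin (d + 2) → ℝ}
    (hs : ∀ v, IsKer 1 i s v → v = 0) : N i (fun j => Matrix.diagonal (s j)) base ≠ 0 := by
  refine stackDet_ne_zero fun v hv => hs v fun j a => ?_
  have := hv j a
  rw [blockN, blockJ, Matrix.add_mulVec, Matrix.sub_mulVec, ← Matrix.mulVec_mulVec,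
    ← Matrix.mulVec_mulVec, Matrix.diagonal_sub, Pi.add_apply, Pi.sub_apply,
    Matrix.mulVec_diagonal, Matrix.mulVec_diagonal, jacobi_zeta_fst, jacobi_zeta_snd,
    jacobi_kappa_smul] at this
  linarith

/-! ### Triviality of the kernels -/

@[simp] theorem sum_Iio_zero (D : Fin 5 → ℝ) : ∑ m ∈ Finset.Iio 0, D m = 0 := rfl

@[simp] theorem sum_Iio_one (D : Fin 5 → ℝ) : ∑ m ∈ Finset.Iio 1, D m = D 0 := by
  rw [show (Finset.Iio 1 : Finset (Fin 5)) = {0} by decide]; simp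

@[simp] theorem sum_Iio_two (D : Fin 5 → ℝ) : ∑ m ∈ Finset.Iio 2, D m = D 0 + D 1 := by
  rw [show (Finset.Iio 2 : Finset (Fin 5)) = {0, 1} by decide]; simp

@[simp] theorem sum_Iio_three (D : Fin 5 → ℝ) :
    ∑ m ∈ Finset.Iio 3, D m = D 0 + D 1 + D 2 := by
  rw [show (Finset.Iio 3 : Finset (Fin 5)) = {0, 1, 2} by decide]; simp [add_assoc]

@[simp] theorem sum_Iio_four (D : Fin 5 → ℝ) :
    ∑ m ∈ Finset.Iio 4, D m = D 0 + D 1 + D 2 + D 3 := by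
  rw [show (Finset.Iio 4 : Finset (Fin 5)) = {0, 1, 2, 3} by decide]; simp [add_assoc]

theorem forall_fin_five {P : Fin 5 → Prop} : (∀ j, P j) ↔ P 0 ∧ P 1 ∧ P 2 ∧ P 3 ∧ P 4 := by
  simp only [Fin.forall_fin_succ, IsEmpty.forall_iff, and_true]
  rfl

/-- The diagonal entries of `H_j` at the point where `𝒥_i` and `𝒩_i` are shown not to vanish. For
the component `a = (k, ℓ)`, the two rows of a matrix list the entries for `k = 0` and `k = 1`, with
`j = 0, …, 4`. For `ℓ = 0` one pattern is used for `i < 3` and another for `i ≥ 3`; for `ℓ = 1` all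
entries are `1`, and there is a common pattern for all `ℓ ≥ 2`. For each `k`, and for `ℓ = 0` as
well as for `ℓ ≥ 2`, there are exactly as many entries `0` as free `y`-coordinates. -/
def weight (i j : Fin 5) (a : Fin 2 × Fin (d + 2)) : ℝ :=
  (Fin.cons (if i < 3 then ![![1, 0, 0, 1, 0], ![0, 1, 1, 0, 0]] a.1 j
      else ![![1, 0, 1, 0, 0], ![1, 1, 0, 0, 0]] a.1 j)
    (Fin.cons 1 fun _ => ![![1, 0, 0, 0, 0], ![0, 0, 1, 0, 0]] a.1 j) : Fin (d + 2) → ℝ) a.2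

theorem dh₁_ext (v : Coord d → ℝ) (k : Fin 2) (l : Fin d) : dh₁ v (k, l.succ.succ) =
    fun m => pBase k m * ![-(v (.x3 l.succ) + v (.xbar4 l)), -(v (.x3 l.succ) + v (.xbar4 l)),
      v (.x3 l.succ), v (.xbar4 l), 0] m := by
  funext m; simp [dh₁, aBase, da]

theorem dκh₁_ext (v : Coord d → ℝ) (k : Fin 2) (l : Fin d) (m : Fin 5) :
    dκh₁ v (k, l.succ.succ) m = 0 := by
  simp [dκh₁, aBase]

theorem dh₂_ext (v : Coord d → ℝ) (k : Fin 2) (l : Fin d) : dh₂ v (k, l.succ.succ) =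
    ![v (.y k 0 l.succ), v (.y k 1 l.succ),
      v (.y k 2 l.succ), -(v (.y k 0 l.succ) + v (.y k 1 l.succ) + v (.y k 2 l.succ)
        + v (.ybar5 k l)), v (.ybar5 k l)] := by
  funext m; simp only [dh₂, h_snd_withY_succ_succ]

theorem dh₁_zero (v : Coord d → ℝ) (k : Fin 2) : dh₁ v (k, 0) =
    fun m => dp v k m * ![1, 10, 1, 1, 2] m
      + pBase k m * ![0, v (.q 0 1) + 2 * v (.x3 0) + 7 * v (.q 1 1), 0, 0, 0] m := by
  funext m; simp [dh₁, aBase, da]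

theorem dh₁_one (v : Coord d → ℝ) (k : Fin 2) : dh₁ v (k, 1) =
    fun m => dp v k m * ![-7 / 2, 1, 1, 4, 1] m + pBase k m *
      ![-(v (.q 0 0) + 7 * v (.q 1 0)) / 2 - v (.x3 0), 0, v (.x3 0), 0, 0] m := by
  funext m
  rw [dh₁, ← Fin.succ_zero_eq_one]
  simp only [aBase, da, Fin.cons_succ, Fin.cons_zero]

theorem dκh₁_zero (v : Coord d → ℝ) (k : Fin 2) : dκh₁ v (k, 0) =
    fun m => v (.kappa m) * (pBase k m * ![1, 10, 1, 1, 2] m) := rfl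

theorem dκh₁_one (v : Coord d → ℝ) (k : Fin 2) : dκh₁ v (k, 1) =
    fun m => v (.kappa m) * (pBase k m * ![-7 / 2, 1, 1, 4, 1] m) := rfl

theorem dh₂_zero (v : Coord d → ℝ) (k : Fin 2) : dh₂ v (k, 0) =
    ![7 / 2 * v (.y k 0 0), v (.y k 1 0), -v (.y k 2 0),
      -4 * (toParam (withY base v)).y4 k 0, (toParam (withY base v)).y51 k] := by
  funext m; simp only [dh₂, h_snd_withY_zero]

theorem dh₂_one (v : Coord d → ℝ) (k : Fin 2) : dh₂ v (k, 1) =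
    ![v (.y k 0 0), -10 * v (.y k 1 0), v (.y k 2 0),
      (toParam (withY base v)).y4 k 0, -2 * (toParam (withY base v)).y51 k] := by
  funext m; simp only [dh₂, h_snd_withY_one]

/-- Only the equations of the components `(k, 0)` are needed: those with weight `0` determine the
first `y`-coordinates. -/
theorem IsKer.y_zero {c : ℝ} (hc : c = 0 ∨ c = 1) {i : Fin 5} {v : Coord d → ℝ}
    (hv : IsKer c i (weight i) v) (k : Fin 2) :
    v (.y k 0 0) = 0 ∧ v (.y k 1 0) = 0 ∧ v (.y k 2 0) = 0 := by
  have e (j : Fin 5) := hv j (k, 0)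
  have h4 := y4_withY_zero v k
  have h5 := y51_withY v k
  simp only [dh₂_zero] at e
  -- The equations with weight `0` involve the variations of `h¹` at most through the common term
  -- of `𝒩_i`, so their values need not be known.
  generalize (toParam (withY base v)).y4 k 0 = y4 at *
  generalize (toParam (withY base v)).y51 k = y5 at *
  generalize dh₁ v (k, 0) = U at *
  generalize dκh₁ v (k, 0) = K at *
  rw [forall_fin_five] at e
  clear hv
  rcases hc with rfl | rfl <;> fin_cases i <;> fin_cases k <;>
    simp [weight, shift] at e h4 h5 ⊢ <;> grind

set_option maxHeartbeats 1000000 in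
/-- Once the first `y`-coordinates of `v` vanish, the equations of the components `ℓ = 0, 1` with
weight `1` form a linear system of size `14` for the remaining main coordinates. -/
theorem IsKer.main_zero {c : ℝ} (hc : c = 0 ∨ c = 1) {i : Fin 5} {v : Coord d → ℝ}
    (hv : IsKer c i (weight i) v) :
    (∀ m k, v (.p m k) = 0) ∧ (∀ m k, v (.q m k) = 0) ∧ v (.x3 0) = 0 ∧
      ∀ m, v (.kappa m) = 0 := by
  have hy := hv.y_zero hc
  have h4 (k : Fin 2) : (toParam (withY base v)).y4 k 0 = 0 := by
    simp [y4_withY_zero, y51_withY, hy]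
  have h5 (k : Fin 2) : (toParam (withY base v)).y51 k = 0 := by
    simp [y51_withY, hy]
  have e (k : Fin 2) (j : Fin 5) := hv j (k, 0)
  have f (k : Fin 2) (j : Fin 5) := hv j (k, 1)
  simp only [dh₁_zero, dκh₁_zero, dh₂_zero, dh₁_one, dκh₁_one, dh₂_one, hy, h4, h5,
    Fin.forall_fin_two, forall_fin_five] at e f ⊢
  clear hv hy h4 h5
  rcases hc with rfl | rfl <;> fin_cases i <;>
    simp [weight, pBase, shift, dp, Fin.cons_one] at e f <;> grind (splits := 20)

/-- The `10` equations of the components `(k, ℓ)` with a fixed `ℓ ≥ 2` involve exactly the `10`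
coordinates of `v` belonging to `ℓ`. -/
theorem IsKer.ext_zero {c : ℝ} (hc : c = 0 ∨ c = 1) {i : Fin 5} {v : Coord d → ℝ}
    (hv : IsKer c i (weight i) v) (l : Fin d) :
    v (.x3 l.succ) = 0 ∧ v (.xbar4 l) = 0 ∧ (∀ k j, v (.y k j l.succ) = 0) ∧
      ∀ k, v (.ybar5 k l) = 0 := by
  have e (k : Fin 2) (j : Fin 5) := hv j (k, l.succ.succ)
  simp only [dh₁_ext, dκh₁_ext, dh₂_ext, Fin.forall_fin_two, forall_fin_five] at e
  have h3 {P : Fin 3 → Prop} : (∀ j, P j) ↔ P 0 ∧ P 1 ∧ P 2 := by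
    simp only [Fin.forall_fin_succ, IsEmpty.forall_iff, and_true]; rfl
  simp only [Fin.forall_fin_two, h3]
  clear hv
  rcases hc with rfl | rfl <;> fin_cases i <;> simp [weight, pBase, shift] at e <;> grind

theorem IsKer.eq_zero {c : ℝ} (hc : c = 0 ∨ c = 1) {i : Fin 5} {v : Coord d → ℝ}
    (hv : IsKer c i (weight i) v) : v = 0 := by
  obtain ⟨hp, hq, hx, hκ⟩ := hv.main_zero hc
  have hy := hv.y_zero hc
  have he := hv.ext_zero hc
  funext z
  match z with
  | .p i k => exact hp i k
  | .q i k => exact hq i k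
  | .x3 l => exact Fin.cases hx (fun l => (he l).1) l
  | .xbar4 l => exact (he l).2.1
  | .y k j l =>
    refine Fin.cases ?_ (fun l => (he l).2.2.1 k j) l
    fin_cases j
    exacts [(hy k).1, (hy k).2.1, (hy k).2.2]
  | .ybar5 k l => exact (he l).2.2.2 k
  | .kappa i => exact hκ i

/-! ### Openness and density of `P0` -/

/-- The point of `P1` given by `base` and the diagonal matrices with entries `weight i j`. -/
def basePoint (d : ℕ) (i : Fin 5) : P1 d :=
  (fun j => ⟨Matrix.diagonal (weight i j), Matrix.isSymm_diagonal _⟩, base)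

theorem J_basePoint (i : Fin 5) :
    J i (fun j => ((basePoint d i).1 j : BigMat d)) (basePoint d i).2 ≠ 0 :=
  J_ne_zero fun _ hv => hv.eq_zero (.inl rfl)

theorem N_basePoint (i : Fin 5) :
    N i (fun j => ((basePoint d i).1 j : BigMat d)) (basePoint d i).2 ≠ 0 :=
  N_ne_zero fun _ hv => hv.eq_zero (.inr rfl)

theorem isAnalytic_J (i : Fin 5) : IsAnalytic (J (d := d) i) :=
  fun _ _ _ _ _ hH hZ => contDiff_J i hH hZ

theorem isAnalytic_N (i : Fin 5) : IsAnalytic (N (d := d) i) :=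
  fun _ _ _ _ _ hH hZ => contDiff_N i hH hZ

theorem P0_eq (d : ℕ) : P0 d =
    (⋂ i, {u | J i (fun j => (u.1 j : BigMat d)) u.2 ≠ 0}) ∩
      ⋂ i, {u | N i (fun j => (u.1 j : BigMat d)) u.2 ≠ 0} := by
  ext u
  simp [P0, Q, Finset.prod_eq_zero_iff]

theorem dense_iInter {ι X : Type*} [Finite ι] [TopologicalSpace X] {s : ι → Set X}
    (ho : ∀ i, IsOpen (s i)) (hd : ∀ i, Dense (s i)) : Dense (⋂ i, s i) := by
  rw [← Set.sInter_range]
  exact (Set.finite_range s).dense_sInter (Set.forall_mem_range.2 ho) (Set.forall_mem_range.2 hd)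

theorem isOpen_P0_and_dense_P0 (d : ℕ) : IsOpen (P0 d) ∧ Dense (P0 d) := by
  have hJo (i : Fin 5) : IsOpen {u : P1 d | J i (fun j => (u.1 j : BigMat d)) u.2 ≠ 0} :=
    isOpen_ne_fun (isAnalytic_J i).continuous continuous_const
  have hNo (i : Fin 5) : IsOpen {u : P1 d | N i (fun j => (u.1 j : BigMat d)) u.2 ≠ 0} :=
    isOpen_ne_fun (isAnalytic_N i).continuous continuous_const
  have hJd := dense_iInter hJo fun i => (isAnalytic_J i).dense (J_basePoint i)
  have hNd := dense_iInter hNo fun i => (isAnalytic_N i).dense (N_basePoint i)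
  rw [P0_eq]
  exact ⟨(isOpen_iInter_of_finite hJo).inter (isOpen_iInter_of_finite hNo),
    hJd.inter_of_isOpen_left hNd (isOpen_iInter_of_finite hJo)⟩

end TConfig

end

theorem theorem5p9 (d : ℕ) :
    (∃ u : TConfig.P1 d, TConfig.Q u ≠ 0) ∧
      IsOpen (TConfig.P0 d) ∧ Dense (TConfig.P0 d) :=
  have h := TConfig.isOpen_P0_and_dense_P0 d
  ⟨(h.2.nonempty_iff.2 ⟨TConfig.basePoint d 0⟩), h⟩
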